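/- Let $n\ge 2$, and let $\mathrm{SU}(n,1)$ be the group of complex $(n+1)\times(n+1)$ matrices of determinant $1$ that preserve the Hermitian form $\langle z,w\rangle=w^{*}\,\mathrm{diag}(-1,1,\dots,1)\,z$ of signature $(n,1)$ on $\mathbb{C}^{n+1}$. A pair $(g_1,g_2)$ of elements of a group $G$ is called strongly doubly reversible if there is $h\in G$ with $h^2=1$ such that $hg_1h^{-1}=g_1^{-1}$ and $hg_2h^{-1}=g_2^{-1}$. Then the set of strongly doubly reversible pairs in $G=\mathrm{SU}(n,1)$ has Haar measure zero in $\mathrm{SU}(n,1)\times\mathrm{SU}(n,1)$. -/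

import Mathlib

open scoped Matrix
open MeasureTheory

/-- A pair `(g₁, g₂)` of elements of a group `G` is strongly doubly reversible if it is conjugate to
`(g₁⁻¹, g₂⁻¹)` under simultaneous conjugation by some `h : G` with `h ^ 2 = 1`. -/
def StronglyDoublyReversible {G : Type*} [Group G] (g₁ g₂ : G) : Prop :=
  ∃ h : G, h ^ 2 = 1 ∧ h * g₁ * h⁻¹ = g₁⁻¹ ∧ h * g₂ * h⁻¹ = g₂⁻¹

/-- The Gram matrix `diag(-1, 1, …, 1)` of size `n + 1` of the standard Hermitian form of
signature `(n, 1)` on `ℂ^(n+1)`, namely `⟨z, w⟩ = wᴴ * lorentzForm n * z`. -/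
def lorentzForm (n : ℕ) : Matrix (Fin (n + 1)) (Fin (n + 1)) ℂ :=
  Matrix.diagonal fun i => if i = 0 then -1 else 1

/-- The group `SU(n,1)` of complex `(n+1) × (n+1)` matrices of determinant one preserving the
Hermitian form of signature `(n, 1)`. As a subgroup of `SL(n+1, ℂ)` it carries the topology induced
from the space of matrices. -/
def SUn1 (n : ℕ) : Subgroup (Matrix.SpecialLinearGroup (Fin (n + 1)) ℂ) where
  carrier := {A | (A : Matrix (Fin (n + 1)) (Fin (n + 1)) ℂ)ᴴ * lorentzForm n *
    (A : Matrix (Fin (n + 1)) (Fin (n + 1)) ℂ) = lorentzForm n}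
  one_mem' := by simp
  mul_mem' := by
    intro A B hA hB
    simp only [Set.mem_ofPred_eq, Matrix.SpecialLinearGroup.coe_mul,
      Matrix.conjTranspose_mul] at *
    calc _ = (B : Matrix (Fin (n + 1)) (Fin (n + 1)) ℂ)ᴴ *
          ((A : Matrix (Fin (n + 1)) (Fin (n + 1)) ℂ)ᴴ * lorentzForm n * A) * B := by
            simp only [Matrix.mul_assoc]
      _ = _ := by rw [hA, hB]
  inv_mem' := by
    intro A hA
    simp only [Set.mem_ofPred_eq] at *
    have h : (A : Matrix (Fin (n + 1)) (Fin (n + 1)) ℂ) *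
        ((A⁻¹ : Matrix.SpecialLinearGroup (Fin (n + 1)) ℂ) :
          Matrix (Fin (n + 1)) (Fin (n + 1)) ℂ) = 1 := by
      rw [← Matrix.SpecialLinearGroup.coe_mul, mul_inv_cancel, Matrix.SpecialLinearGroup.coe_one]
    set B := ((A⁻¹ : Matrix.SpecialLinearGroup (Fin (n + 1)) ℂ) :
          Matrix (Fin (n + 1)) (Fin (n + 1)) ℂ)
    have h' := congrArg Matrix.conjTranspose h
    rw [Matrix.conjTranspose_mul, Matrix.conjTranspose_one] at h'
    calc _ = Bᴴ * ((A : Matrix (Fin (n + 1)) (Fin (n + 1)) ℂ)ᴴ * lorentzForm n * A) * B := by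
            rw [hA]
      _ = (Bᴴ * (A : Matrix (Fin (n + 1)) (Fin (n + 1)) ℂ)ᴴ) * lorentzForm n * (A * B) := by
            simp only [Matrix.mul_assoc]
      _ = _ := by rw [h', h, Matrix.one_mul, Matrix.mul_one]

/-- `SU(n,1)` carries its Borel `σ`-algebra. -/
noncomputable instance (n : ℕ) : MeasurableSpace (SUn1 n) := borel _

instance (n : ℕ) : BorelSpace (SUn1 n) := ⟨rfl⟩

/-- `SU(n,1)` is second countable, so that the product `σ`-algebra on `SU(n,1) × SU(n,1)` is the
Borel `σ`-algebra. -/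
instance (n : ℕ) : SecondCountableTopology (SUn1 n) := by
  have h : Topology.IsInducing
      (fun A : SUn1 n => ((A : Matrix.SpecialLinearGroup (Fin (n + 1)) ℂ) :
        Matrix (Fin (n + 1)) (Fin (n + 1)) ℂ)) :=
    Topology.IsInducing.subtypeVal.comp Topology.IsInducing.subtypeVal
  have : SecondCountableTopology (Matrix (Fin (n + 1)) (Fin (n + 1)) ℂ) :=
    inferInstanceAs (SecondCountableTopology (Fin (n + 1) → Fin (n + 1) → ℂ))
  exact h.secondCountableTopology

/-- `SU(n,1)` is locally compact, so that Haar measures exist. -/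
instance (n : ℕ) : LocallyCompactSpace (SUn1 n) := by
  have h : Topology.IsInducing
      (fun A : SUn1 n => ((A : Matrix.SpecialLinearGroup (Fin (n + 1)) ℂ) :
        Matrix (Fin (n + 1)) (Fin (n + 1)) ℂ)) :=
    Topology.IsInducing.subtypeVal.comp Topology.IsInducing.subtypeVal
  have hinj : Function.Injective
      (fun A : SUn1 n => ((A : Matrix.SpecialLinearGroup (Fin (n + 1)) ℂ) :
        Matrix (Fin (n + 1)) (Fin (n + 1)) ℂ)) :=
    Subtype.val_injective.comp Subtype.val_injective
  have hr : Set.range (fun A : SUn1 n => ((A : Matrix.SpecialLinearGroup (Fin (n + 1)) ℂ) :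
        Matrix (Fin (n + 1)) (Fin (n + 1)) ℂ)) =
      {M | M.det = 1} ∩ {M | Mᴴ * lorentzForm n * M = lorentzForm n} := by
    ext M
    constructor
    · rintro ⟨A, rfl⟩
      exact ⟨A.1.2, A.2⟩
    · rintro ⟨h1, h2⟩
      exact ⟨⟨⟨M, h1⟩, h2⟩, rfl⟩
  have : LocallyCompactSpace (Matrix (Fin (n + 1)) (Fin (n + 1)) ℂ) :=
    inferInstanceAs (LocallyCompactSpace (Fin (n + 1) → Fin (n + 1) → ℂ))
  refine Topology.IsClosedEmbedding.locallyCompactSpace ⟨⟨h, hinj⟩, ?_⟩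
  rw [hr]
  exact (isClosed_eq (by fun_prop) continuous_const).inter
    (isClosed_eq (by fun_prop) continuous_const)

/-! Inverting an element of `SU(n,1)` conjugates its trace, so an element conjugate to its inverse
has real trace. It remains to see that real trace of the first component is a null condition. Left
translation by `torusElement hn z` turns the trace into `a z² + b z̄ + c`, where `a` is the top-left
entry and is never zero. Its imaginary part vanishes for only finitely many `z` on the circle, and
Fubini with left invariance concludes (`measure_eq_zero_of_forall_translate_null`). The exponents
`2, -1, -1` matter: with `z, z̄` the imaginary part of `a z + b z̄ + c` could vanish identically,
when `b = ā` and `c` is real. -/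

theorem circle_mul_star (z : Circle) : (z : ℂ) * star (z : ℂ) = 1 := by
  rw [Complex.star_def, Complex.mul_conj, Circle.normSq_coe, Complex.ofReal_one]

/-- The diagonal `(z², z̄, z̄, 1, …, 1)`. -/
def torusDiag (n : ℕ) (z : ℂ) : Fin (n + 1) → ℂ :=
  fun i => if i.val = 0 then z ^ 2 else if i.val ≤ 2 then star z else 1

theorem torusDiag_zero (n : ℕ) (z : ℂ) : torusDiag n z 0 = z ^ 2 :=
  rfl

theorem torusDiag_succ_zero (m : ℕ) (z : ℂ) : torusDiag (m + 2) z (Fin.succ 0) = star z :=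
  rfl

theorem torusDiag_succ_succ_zero (m : ℕ) (z : ℂ) :
    torusDiag (m + 2) z (Fin.succ (Fin.succ 0)) = star z :=
  rfl

theorem torusDiag_succ_succ_succ {m : ℕ} (z : ℂ) (i : Fin m) :
    torusDiag (m + 2) z i.succ.succ.succ = 1 := by
  simp [torusDiag]

theorem prod_torusDiag {n : ℕ} (hn : 2 ≤ n) (z : Circle) : ∏ i, torusDiag n z i = 1 := by
  obtain ⟨m, rfl⟩ := Nat.exists_eq_add_of_le' hn
  have hz := circle_mul_star z
  rw [Fin.prod_univ_succ, Fin.prod_univ_succ, Fin.prod_univ_succ, Finset.prod_eq_one]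
  · rw [torusDiag_succ_zero, torusDiag_succ_succ_zero, torusDiag_zero]
    linear_combination ((z : ℂ) * star (z : ℂ) + 1) * hz
  · exact fun i _ => torusDiag_succ_succ_succ _ i

theorem star_torusDiag_mul_self {n : ℕ} (z : Circle) (i : Fin (n + 1)) :
    star (torusDiag n z i) * torusDiag n z i = 1 := by
  have hz := circle_mul_star z
  unfold torusDiag
  split_ifs
  · rw [star_pow]
    linear_combination ((z : ℂ) * star (z : ℂ) + 1) * hz
  · rw [star_star, hz]
  · simp

/-- The element `diag(z², z⁻¹, z⁻¹, 1, …, 1)` of `SU(n,1)`, for `|z| = 1`. -/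
def torusElement {n : ℕ} (hn : 2 ≤ n) (z : Circle) : SUn1 n :=
  ⟨⟨Matrix.diagonal (torusDiag n z), by rw [Matrix.det_diagonal, prod_torusDiag hn]⟩, by
    change (Matrix.diagonal (torusDiag n z))ᴴ * lorentzForm n *
      Matrix.diagonal (torusDiag n z) = lorentzForm n
    rw [lorentzForm, Matrix.diagonal_conjTranspose, Matrix.diagonal_mul_diagonal,
      Matrix.diagonal_mul_diagonal]
    congr 1
    funext i
    rw [mul_right_comm, Pi.star_apply, star_torusDiag_mul_self, one_mul]⟩

theorem continuous_torusElement {n : ℕ} (hn : 2 ≤ n) : Continuous (torusElement hn) := by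
  refine Continuous.subtype_mk (Continuous.subtype_mk ?_ _) _
  refine Continuous.matrix_diagonal (continuous_pi fun i => ?_)
  unfold torusDiag
  split_ifs <;> fun_prop

namespace SUn1

/-- The underlying matrix of an element of `SU(n,1)`. -/
def toMatrix {n : ℕ} (g : SUn1 n) : Matrix (Fin (n + 1)) (Fin (n + 1)) ℂ :=
  (g : Matrix.SpecialLinearGroup (Fin (n + 1)) ℂ)

theorem toMatrix_mul {n : ℕ} (g h : SUn1 n) : toMatrix (g * h) = toMatrix g * toMatrix h := by
  simp [toMatrix]

theorem toMatrix_one {n : ℕ} : toMatrix (1 : SUn1 n) = 1 := by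
  simp [toMatrix]

theorem continuous_toMatrix {n : ℕ} : Continuous (toMatrix (n := n)) :=
  continuous_subtype_val.comp continuous_subtype_val

theorem conjTranspose_mul_lorentzForm_mul {n : ℕ} (g : SUn1 n) :
    (toMatrix g)ᴴ * lorentzForm n * toMatrix g = lorentzForm n :=
  g.2

/-- The first column has form value `-1`; if its top entry were zero, that value would be a sum of
squared moduli. -/
theorem apply_zero_zero_ne_zero {n : ℕ} (g : SUn1 n) : toMatrix g 0 0 ≠ 0 := by
  intro h0
  have h := congrFun (congrFun (conjTranspose_mul_lorentzForm_mul g) 0) 0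
  rw [lorentzForm, Matrix.mul_apply] at h
  simp only [Matrix.mul_diagonal, Matrix.conjTranspose_apply, Matrix.diagonal_apply_eq,
    if_true] at h
  rw [Fin.sum_univ_succ, h0] at h
  have h' := congrArg Complex.re h
  simp only [Fin.succ_ne_zero, if_false, mul_one, mul_zero, zero_add, Complex.re_sum] at h'
  have hnn : 0 ≤ ∑ i : Fin n, (star (toMatrix g i.succ 0) * toMatrix g i.succ 0).re :=
    Finset.sum_nonneg fun i _ => by
      simp only [Complex.star_def, Complex.mul_re, Complex.conj_re, Complex.conj_im]
      nlinarith [sq_nonneg (toMatrix g i.succ 0).re, sq_nonneg (toMatrix g i.succ 0).im]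
  rw [h'] at hnn
  norm_num at hnn

theorem lorentzForm_mul_self (n : ℕ) : lorentzForm n * lorentzForm n = 1 := by
  rw [lorentzForm, Matrix.diagonal_mul_diagonal, ← Matrix.diagonal_one]
  congr 1
  funext i
  split_ifs <;> norm_num

theorem toMatrix_inv {n : ℕ} (g : SUn1 n) :
    toMatrix g⁻¹ = lorentzForm n * (toMatrix g)ᴴ * lorentzForm n := by
  have h : lorentzForm n * (toMatrix g)ᴴ * lorentzForm n * toMatrix g = 1 := by
    rw [Matrix.mul_assoc, Matrix.mul_assoc, ← Matrix.mul_assoc (toMatrix g)ᴴ,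
      (conjTranspose_mul_lorentzForm_mul g), lorentzForm_mul_self]
  have h' : toMatrix g * toMatrix g⁻¹ = 1 := by
    rw [← toMatrix_mul, mul_inv_cancel, toMatrix_one]
  exact (left_inv_eq_right_inv h h').symm

theorem trace_inv {n : ℕ} (g : SUn1 n) :
    (toMatrix g⁻¹).trace = star (toMatrix g).trace := by
  rw [toMatrix_inv, Matrix.trace_mul_comm, ← Matrix.mul_assoc, lorentzForm_mul_self,
    Matrix.one_mul, Matrix.trace_conjTranspose]

theorem trace_conj {n : ℕ} (h g : SUn1 n) :
    (toMatrix (h * g * h⁻¹)).trace = (toMatrix g).trace := by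
  rw [toMatrix_mul, Matrix.trace_mul_comm, ← toMatrix_mul, ← mul_assoc, inv_mul_cancel, one_mul]

/-- An element of `SU(n,1)` that is conjugate to its inverse has real trace. -/
theorem trace_im_eq_zero_of_conj_eq_inv {n : ℕ} {h g : SUn1 n} (hg : h * g * h⁻¹ = g⁻¹) :
    (toMatrix g).trace.im = 0 := by
  rw [← Complex.conj_eq_iff_im, ← Complex.star_def, ← trace_inv, ← hg, trace_conj]

theorem trace_torusElement_mul {n : ℕ} (hn : 2 ≤ n) (g : SUn1 n) :
    ∃ b c : ℂ, ∀ z : Circle, (toMatrix (torusElement hn z * g)).trace =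
      (z : ℂ) ^ 2 * toMatrix g 0 0 + star (z : ℂ) * b + c := by
  obtain ⟨m, rfl⟩ := Nat.exists_eq_add_of_le' hn
  refine ⟨toMatrix g 1 1 + toMatrix g 2 2,
    ∑ i : Fin m, toMatrix g i.succ.succ.succ i.succ.succ.succ, fun z => ?_⟩
  have hu : toMatrix (torusElement hn z) = Matrix.diagonal (torusDiag (m + 2) z) := rfl
  rw [toMatrix_mul, hu, Matrix.trace]
  simp only [Matrix.diag_apply, Matrix.diagonal_mul]
  rw [Fin.sum_univ_succ, Fin.sum_univ_succ, Fin.sum_univ_succ]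
  have h1 : (Fin.succ 0 : Fin (m + 3)) = 1 := rfl
  have h2 : (Fin.succ (Fin.succ 0) : Fin (m + 3)) = 2 := rfl
  simp only [torusDiag_zero, torusDiag_succ_zero, torusDiag_succ_succ_zero,
    torusDiag_succ_succ_succ, one_mul]
  rw [h1, h2]
  ring

end SUn1

/-- Lets finiteness on the circle become Lebesgue-nullity on `ℝ`. -/
theorem countable_preimage_circle_exp {S : Set Circle} (hS : S.Countable) :
    (Circle.exp ⁻¹' S).Countable := by
  have hinj : Function.Injective fun t : ℝ => (t : ℂ) * Complex.I :=
    (mul_left_injective₀ Complex.I_ne_zero).comp Complex.ofReal_injective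
  refine (((hS.image ((↑) : Circle → ℂ)).preimage_cexp).preimage hinj).mono fun t ht => ?_
  exact ⟨Circle.exp t, ht, Circle.coe_exp t⟩

open Polynomial in
/-- A trigonometric polynomial `Im (a z² + b z̄ + c)` with `a ≠ 0` has finitely many zeros on the
circle. -/
theorem finite_circle_im_eq_zero {a : ℂ} (ha : a ≠ 0) (b c : ℂ) :
    {z : Circle | ((z : ℂ) ^ 2 * a + star (z : ℂ) * b + c).im = 0}.Finite := by
  -- This is `z²` times `w - star w` for `w = a z² + b z̄ + c`, with `z̄` replaced by `z⁻¹`.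
  let P : ℂ[X] :=
    C a * X ^ 4 + (C (-star b) * X ^ 3 + C (c - star c) * X ^ 2 + C b * X + C (-star a))
  have hP : P ≠ 0 := by
    intro h
    have h4 := congrArg (fun q : ℂ[X] => q.coeff 4) h
    simp only [P, coeff_add, coeff_C_mul, coeff_X_pow, coeff_X, coeff_C, coeff_zero] at h4
    norm_num at h4
    exact ha h4
  refine ((Polynomial.finite_setOfPred_isRoot hP).preimage
    (f := fun z : Circle => (z : ℂ)) Subtype.val_injective.injOn).subset fun z hz => ?_
  have hzz := circle_mul_star z
  rw [Set.mem_ofPred_eq, ← Complex.conj_eq_iff_im, ← Complex.star_def] at hz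
  simp only [star_add, star_mul', star_pow, star_star] at hz
  change P.eval (z : ℂ) = 0
  simp only [P, eval_add, eval_mul, eval_C, eval_pow, eval_X]
  linear_combination (-(z : ℂ) ^ 2) * hz + star a * ((z : ℂ) * star (z : ℂ) + 1) * hzz
    - (z : ℂ) * b * hzz

/-- Let `u` be a continuous family in `G`. A closed set `E` such that, for every `g`, the parameters
`t` with `u t * g ∈ E` form a null set is null for every left-invariant measure. -/
theorem measure_eq_zero_of_forall_translate_null {G T : Type*} [Group G] [TopologicalSpace G]
    [IsTopologicalGroup G] [MeasurableSpace G] [BorelSpace G] [SecondCountableTopology G]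
    [TopologicalSpace T] [MeasurableSpace T] [BorelSpace T] [SecondCountableTopology T]
    (μ : Measure G) [μ.IsMulLeftInvariant] [SFinite μ] (ν : Measure T) [SFinite ν] [NeZero ν]
    {u : T → G} (hu : Continuous u) {E : Set G} (hE : IsClosed E)
    (h : ∀ g, ν {t | u t * g ∈ E} = 0) : μ E = 0 := by
  have hF : MeasurableSet {p : T × G | u p.1 * p.2 ∈ E} :=
    (hE.preimage ((hu.comp continuous_fst).mul continuous_snd)).measurableSet
  have h0 : (ν.prod μ) {p : T × G | u p.1 * p.2 ∈ E} = 0 := by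
    rw [Measure.prod_apply_symm hF]
    simp only [Set.preimage_ofPred_eq, h, lintegral_zero]
  have hae := Measure.measure_ae_null_of_prod_null h0
  -- Since `ν ≠ 0`, some single translate of `E` is null, and one is enough by invariance.
  obtain ⟨t, ht⟩ := hae.exists
  rw [← measure_preimage_mul μ (u t) E]
  exact ht

theorem mainTheorem10 (n : ℕ) (hn : 2 ≤ n)
    (μ : Measure (SUn1 n × SUn1 n)) [μ.IsHaarMeasure] :
    μ {p : SUn1 n × SUn1 n | StronglyDoublyReversible p.1 p.2} = 0 := by
  have hsub : {p : SUn1 n × SUn1 n | StronglyDoublyReversible p.1 p.2} ⊆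
      {p | (SUn1.toMatrix p.1).trace.im = 0} := by
    rintro p ⟨h, -, h1, -⟩
    exact SUn1.trace_im_eq_zero_of_conj_eq_inv h1
  refine measure_mono_null hsub ?_
  -- The circle is parametrized by `ℝ` through `Circle.exp`, and only the first factor is moved.
  refine measure_eq_zero_of_forall_translate_null μ (volume : Measure ℝ)
    (u := fun t => (torusElement hn (Circle.exp t), 1))
    (((continuous_torusElement hn).comp Circle.exp.continuous).prodMk continuous_const)
    (isClosed_eq ?_ continuous_const) fun p => ?_
  · exact Complex.continuous_im.comp
      (SUn1.continuous_toMatrix.comp continuous_fst).matrix_trace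
  · obtain ⟨b, c, hbc⟩ := SUn1.trace_torusElement_mul hn p.1
    have hfin := finite_circle_im_eq_zero (SUn1.apply_zero_zero_ne_zero p.1) b c
    have hset : {t : ℝ | (torusElement hn (Circle.exp t), (1 : SUn1 n)) * p ∈
        {p : SUn1 n × SUn1 n | (SUn1.toMatrix p.1).trace.im = 0}} = Circle.exp ⁻¹'
        {z : Circle | ((z : ℂ) ^ 2 * SUn1.toMatrix p.1 0 0 + star (z : ℂ) * b + c).im = 0} := by
      ext t
      simp only [Set.mem_ofPred_eq, Set.mem_preimage, Prod.fst_mul, hbc]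
    rw [hset]
    exact (countable_preimage_circle_exp hfin.countable).measure_zero _
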